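/- Let $k$ be a field, $n\ge 1$, and let $M=(f_{ij})$ be a nonzero $n\times n$ matrix over $k$. Let $A=k\langle x_1,\dots,x_n\rangle/(f)$ be the associative $k$-algebra with generators $x_1,\dots,x_n$ and the single relation $f=\sum_{i,j} f_{ij}\,x_ix_j=0$. Assume that $A$ has global dimension $2$ and that $M$ is antisymmetric, i.e. $M^{t}=-M$. Then: 1. $\mathrm{HH}^0(A,A\otimes A)=0$, where $\mathrm{HH}^i(A,N)=\mathrm{Ext}^i_{A^e}(A,N)$, $A^e=A\otimes_k A^{op}$, and $A\otimes A$ carries the outer bimodule structure $b(u\otimes v)c=bu\otimes vc$ (that is, it is $A^e$ as a left $A^e$-module). 2. $A$ is $2$-Calabi–Yau if and only if $M$ is invertible. Here $A$ is called $d$-Calabi–Yau ($d\ge 1$) if $A$ has a finite projective resolution by finitely generated $A$-bimodules, $\mathrm{Ext}^i_{A^e}(A,A^e)=0$ for all $i\ne d$, and $\mathrm{Ext}^d_{A^e}(A,A^e)\cong A$ as right $A^e$-modules. -/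

import Mathlib

open CategoryTheory
open scoped TensorProduct

universe u

noncomputable section

namespace QuadraticCY

/-- The (left) global dimension of a ring: the supremum of the projective dimensions of its
left modules. -/
def globalDimension (S : Type u) [Ring S] : WithBot ℕ∞ :=
  ⨆ X : ModuleCat.{u} S, projectiveDimension X

section Bimodules

variable (k : Type u) [Field k] (A : Type u) [Ring A] [Algebra k A]

/-- The enveloping algebra `Aᵉ = A ⊗ Aᵒᵖ`. -/
abbrev Env : Type u := A ⊗[k] Aᵐᵒᵖ

/-- The bimodule `A`, as a left `Aᵉ`-module: `(b ⊗ c) • a = b * a * c`. -/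
def diagonalBimodule : ModuleCat.{u} (Env k A) :=
  letI : Module (Env k A) A := TensorProduct.Algebra.module
  ModuleCat.of (Env k A) A

/-- The bimodule `A ⊗ A` with its outer structure `b • (u ⊗ v) • c = b * u ⊗ v * c`. As a left
`Aᵉ`-module it is the left regular module `Aᵉ`, since
`(b ⊗ op c) * (u ⊗ op v) = (b * u) ⊗ op (v * c)`. -/
def outerBimodule : ModuleCat.{u} (Env k A) :=
  ModuleCat.of (Env k A) (Env k A)

/-- Hochschild cohomology `HHⁱ(A, N) = Extⁱ_{Aᵉ}(A, N)` with values in a bimodule `N`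
(`k` is a field). -/
abbrev HH (i : ℕ) (N : ModuleCat.{u} (Env k A)) : Type u :=
  Abelian.Ext.{u} (diagonalBimodule k A) N i

/-- Right multiplication by `w` on `Aᵉ`, which is left `Aᵉ`-linear. -/
def rightMul (w : Env k A) : outerBimodule k A ⟶ outerBimodule k A :=
  ModuleCat.ofHom (LinearMap.toSpanSingleton (Env k A) (Env k A) w)

variable {k A} in
/-- The right action of `Aᵉ` on `Extⁱ_{Aᵉ}(A, Aᵉ)`, induced by right multiplication on the
second argument. -/
def extRightAct {i : ℕ} (ξ : HH k A i (outerBimodule k A)) (w : Env k A) :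
    HH k A i (outerBimodule k A) :=
  ξ.comp (Abelian.Ext.mk₀ (rightMul k A w)) (add_zero i)

/-- `A` has a finite projective bimodule resolution by finitely generated bimodules. -/
def HasFiniteProjectiveBimoduleResolution : Prop :=
  ∃ P : ProjectiveResolution (diagonalBimodule k A),
    (∀ i, Module.Finite (Env k A) (P.complex.X i)) ∧
      ∃ N : ℕ, ∀ i, N < i → Limits.IsZero (P.complex.X i)

/-- `A` is `d`-Calabi-Yau (`d ≥ 1`): it has a finite resolution by finitely generated projective
bimodules, `Extⁱ_{Aᵉ}(A, Aᵉ) = 0` for `i ≠ d`, and `Extᵈ_{Aᵉ}(A, Aᵉ) ≅ A` as right `Aᵉ`-modules,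
where `A` is a right `Aᵉ`-module by `a • (b ⊗ op c) = c * a * b` (it suffices to require
compatibility with the elements `b ⊗ op c`, which span `Aᵉ` additively). -/
structure IsCalabiYau (d : ℕ) : Prop where
  one_le : 1 ≤ d
  finite_resolution : HasFiniteProjectiveBimoduleResolution k A
  ext_eq_zero : ∀ i, i ≠ d → ∀ ξ : HH k A i (outerBimodule k A), ξ = 0
  ext_equiv : ∃ e : HH k A d (outerBimodule k A) ≃+ A,
    ∀ (ξ : HH k A d (outerBimodule k A)) (b c : A),
      e (extRightAct ξ (b ⊗ₜ[k] MulOpposite.op c)) = c * e ξ * b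

end Bimodules

section QuadraticAlgebra

variable {k : Type u} [Field k] {n : ℕ}

/-- The element `f = ∑ i j, M i j • x_i x_j` of the free algebra on `x_1, …, x_n`, whose matrix
of coefficients is `M`. -/
def quadraticForm (M : Matrix (Fin n) (Fin n) k) : FreeAlgebra k (Fin n) :=
  ∑ i, ∑ j, M i j • (FreeAlgebra.ι k i * FreeAlgebra.ι k j)

/-- The algebra with generators `x_1, …, x_n` subject to the single relation
`∑ i j, M i j • x_i x_j = 0`. -/
abbrev QuadraticAlg (M : Matrix (Fin n) (Fin n) k) : Type u :=
  RingQuot (fun p q : FreeAlgebra k (Fin n) => p = quadraticForm M ∧ q = 0)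

end QuadraticAlgebra

end QuadraticCY

end

/-! Write `diff x` for `x ⊗ 1 - 1 ⊗ x` in `Aᵉ`. Because `M` is antisymmetric, the linearised
relation is `∑ j, diffCol M j • e_j` with `diffCol M j = ∑ i, M i j • diff x_i`. This gives a
complex `0 → Aᵉ → (Aᵉ)ⁿ → Aᵉ → A → 0` with maps `1 ↦ (diffCol M j)_j`, `e_j ↦ diff x_j` and
multiplication. Exactness at `(Aᵉ)ⁿ` is Fox calculus (`exists_eq_mul_diffCol`). Injectivity on the
left is where the global dimension enters: it forces the linear forms `col M j` to have no common
left annihilator in `A` (`eq_zero_of_mul_col`), and a degree argument carries this over to `Aᵉ`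
(`eq_zero_of_mul_diffCol`).

The anti-automorphism `swap` of `Aᵉ` sends each `diff x` to its negative, so it turns the dual
complex into one of the same kind. Injectivity then gives `HH⁰ = 0`. In degree two, `HH²` is `Aᵉ`
modulo the right ideal generated by the `diffCol M j`.

If `M` is invertible, the `diffCol M j` and the `diff x_j` have the same span. The dual complex is
then exact in the middle, and `HH²` is `Aᵉ` modulo the right ideal of the `diff x_j`, which is `A`.
If `v M = 0` with `v ≠ 0`, a character of `Aᵉ` with values in the dual numbers kills every `diffCol
M j` and every `x_j ⊗ 1` but not every `1 ⊗ x_l`. An isomorphism `HH² ≅ A` would forbid this. -/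

noncomputable section

namespace QuadraticCY

variable {k : Type u} [Field k] {n : ℕ}

/-! ### The quadratic algebra: augmentation, dual numbers, grading. -/

/-- The `i`-th generator of the quadratic algebra. -/
def gen (M : Matrix (Fin n) (Fin n) k) (i : Fin n) : QuadraticAlg M :=
  RingQuot.mkAlgHom k _ (FreeAlgebra.ι k i)

lemma sum_gen_mul_gen (M : Matrix (Fin n) (Fin n) k) :
    ∑ i, ∑ j, M i j • (gen M i * gen M j) = 0 := by
  have h := RingQuot.mkAlgHom_rel k
    (s := fun p q : FreeAlgebra k (Fin n) => p = quadraticForm M ∧ q = 0)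
    (x := quadraticForm M) (y := 0) ⟨rfl, rfl⟩
  rw [map_zero] at h
  have hq : quadraticForm M =
    ∑ i, ∑ j, M i j • (FreeAlgebra.ι k i * FreeAlgebra.ι k j) := rfl
  refine Eq.trans ?_ ((congrArg _ hq).symm.trans h)
  simp only [map_sum, map_smul, map_mul]
  rfl

/-- The universal property of the quadratic algebra. -/
def lift (M : Matrix (Fin n) (Fin n) k) {B : Type*} [Ring B] [Algebra k B] (g : Fin n → B)
    (hg : ∑ i, ∑ j, M i j • (g i * g j) = 0) : QuadraticAlg M →ₐ[k] B :=
  RingQuot.liftAlgHom k ⟨FreeAlgebra.lift k g, by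
    rintro _ _ ⟨rfl, rfl⟩
    simpa [quadraticForm] using hg⟩

@[simp]
lemma lift_gen (M : Matrix (Fin n) (Fin n) k) {B : Type*} [Ring B] [Algebra k B] (g : Fin n → B)
    (hg : ∑ i, ∑ j, M i j • (g i * g j) = 0) (i : Fin n) : lift M g hg (gen M i) = g i := by
  simp [lift, gen]

lemma adjoin_gen (M : Matrix (Fin n) (Fin n) k) :
    Algebra.adjoin k (Set.range (gen M)) = ⊤ := by
  have h : Set.range (gen M) =
      (RingQuot.mkAlgHom k (fun p q : FreeAlgebra k (Fin n) => p = quadraticForm M ∧ q = 0)) ''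
        Set.range (FreeAlgebra.ι k) := by
    rw [← Set.range_comp]; rfl
  rw [h, Algebra.adjoin_image, FreeAlgebra.adjoin_range_ι, Algebra.map_top, AlgHom.range_eq_top]
  exact RingQuot.mkAlgHom_surjective k _

/-- The induction principle used in place of normal forms for elements of the algebra. -/
lemma eq_top_of_gen_mul_mem {M : Matrix (Fin n) (Fin n) k} (S : Submodule k (QuadraticAlg M))
    (h1 : 1 ∈ S) (hS : ∀ i, ∀ b ∈ S, gen M i * b ∈ S) : S = ⊤ := by
  have key : ∀ a : QuadraticAlg M, ∀ b ∈ S, a * b ∈ S := by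
    intro a
    have ha : a ∈ Algebra.adjoin k (Set.range (gen M)) := adjoin_gen M ▸ Algebra.mem_top
    induction ha using Algebra.adjoin_induction with
    | mem x hx => obtain ⟨i, rfl⟩ := hx; exact hS i
    | algebraMap c => intro b hb; rw [← Algebra.smul_def]; exact S.smul_mem c hb
    | add x y _ _ hx hy => intro b hb; rw [add_mul]; exact S.add_mem (hx b hb) (hy b hb)
    | mul x y _ _ hx hy => intro b hb; rw [mul_assoc]; exact hx _ (hy b hb)
  exact eq_top_iff.2 fun a _ => by simpa using key a 1 h1

lemma eq_top_of_mul_gen_mem {M : Matrix (Fin n) (Fin n) k} (S : Submodule k (QuadraticAlg M))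
    (h1 : 1 ∈ S) (hS : ∀ i, ∀ b ∈ S, b * gen M i ∈ S) : S = ⊤ := by
  have key : ∀ a : QuadraticAlg M, ∀ b ∈ S, b * a ∈ S := by
    intro a
    have ha : a ∈ Algebra.adjoin k (Set.range (gen M)) := adjoin_gen M ▸ Algebra.mem_top
    induction ha using Algebra.adjoin_induction with
    | mem x hx => obtain ⟨i, rfl⟩ := hx; exact hS i
    | algebraMap c =>
      intro b hb; rw [← Algebra.commutes, ← Algebra.smul_def]; exact S.smul_mem c hb
    | add x y _ _ hx hy => intro b hb; rw [mul_add]; exact S.add_mem (hx b hb) (hy b hb)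
    | mul x y _ _ hx hy => intro b hb; rw [← mul_assoc]; exact hy _ (hx b hb)
  exact eq_top_iff.2 fun a _ => by simpa using key a 1 h1

/-- The augmentation, killing all generators. -/
def aug (M : Matrix (Fin n) (Fin n) k) : QuadraticAlg M →ₐ[k] k :=
  lift M (fun _ => 0) (by simp)

@[simp]
lemma aug_gen (M : Matrix (Fin n) (Fin n) k) (i : Fin n) : aug M (gen M i) = 0 := lift_gen ..

/-- The algebra morphism to the dual numbers with `x_i ↦ v i • ε`. -/
def toDual (M : Matrix (Fin n) (Fin n) k) (v : Fin n → k) : QuadraticAlg M →ₐ[k] DualNumber k :=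
  lift M (fun i => TrivSqZeroExt.inr (v i)) (by simp)

@[simp]
lemma toDual_gen (M : Matrix (Fin n) (Fin n) k) (v : Fin n → k) (i : Fin n) :
    toDual M v (gen M i) = TrivSqZeroExt.inr (v i) := lift_gen ..

lemma algHom_ext {M : Matrix (Fin n) (Fin n) k} {B : Type*} [Ring B] [Algebra k B]
    {f g : QuadraticAlg M →ₐ[k] B} (h : ∀ i, f (gen M i) = g (gen M i)) : f = g :=
  AlgHom.ext_of_adjoin_eq_top (adjoin_gen M) (by rintro _ ⟨i, rfl⟩; exact h i)

lemma fst_toDual (M : Matrix (Fin n) (Fin n) k) (v : Fin n → k) (a : QuadraticAlg M) :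
    (toDual M v a).fst = aug M a := by
  have h : (TrivSqZeroExt.fstHom k k k).comp (toDual M v) = aug M := algHom_ext (by simp)
  exact DFunLike.congr_fun h a

/-- The linear form `∑ i, M i j • x_i`, the coefficient of `x_j` in the relation. -/
def col (M : Matrix (Fin n) (Fin n) k) (j : Fin n) : QuadraticAlg M := ∑ i, M i j • gen M i

lemma toDual_col (M : Matrix (Fin n) (Fin n) k) (v : Fin n → k) (j : Fin n) :
    toDual M v (col M j) = TrivSqZeroExt.inr ((Matrix.vecMul v M) j) := by
  simp only [col, map_sum, map_smul, toDual_gen, ← TrivSqZeroExt.inr_smul, Matrix.vecMul,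
    dotProduct, smul_eq_mul, mul_comm]
  exact (map_sum (TrivSqZeroExt.inrHom k k) _ _).symm

/-- The morphism `A → A[X]` recording the grading, `x_i ↦ x_i X`. -/
def grading (M : Matrix (Fin n) (Fin n) k) : QuadraticAlg M →ₐ[k] Polynomial (QuadraticAlg M) :=
  lift M (fun i => Polynomial.C (gen M i) * Polynomial.X) (by
    -- The relation is homogeneous, so its image is the relation itself times `X ^ 2`.
    have h (i j : Fin n) : Polynomial.C (gen M i) * Polynomial.X *
        (Polynomial.C (gen M j) * Polynomial.X) =
        Polynomial.C (gen M i * gen M j) * Polynomial.X ^ 2 := by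
      rw [Polynomial.C_mul, mul_assoc, ← mul_assoc Polynomial.X, Polynomial.X_mul_C, pow_two]
      simp only [mul_assoc]
    simp only [h, ← smul_mul_assoc (M _ _) (Polynomial.C _), ← Finset.sum_mul, Polynomial.smul_C]
    simp only [← map_sum, sum_gen_mul_gen, map_zero, zero_mul])

/-- The projection onto the homogeneous component of degree `d`. -/
def component (M : Matrix (Fin n) (Fin n) k) (d : ℕ) : QuadraticAlg M →ₗ[k] QuadraticAlg M :=
  (Polynomial.lcoeff (QuadraticAlg M) d).restrictScalars k ∘ₗ (grading M).toLinearMap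

lemma component_apply (M : Matrix (Fin n) (Fin n) k) (d : ℕ) (a : QuadraticAlg M) :
    component M d a = (grading M a).coeff d := rfl

lemma component_zero_gen_mul (M : Matrix (Fin n) (Fin n) k) (i : Fin n) (a : QuadraticAlg M) :
    component M 0 (gen M i * a) = 0 := by
  simp [component_apply, grading, mul_assoc]

lemma component_succ_gen_mul (M : Matrix (Fin n) (Fin n) k) (d : ℕ) (i : Fin n)
    (a : QuadraticAlg M) : component M (d + 1) (gen M i * a) = gen M i * component M d a := by
  simp [component_apply, grading, mul_assoc, Polynomial.coeff_X_mul]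

lemma component_zero (M : Matrix (Fin n) (Fin n) k) (a : QuadraticAlg M) :
    component M 0 a = algebraMap k _ (aug M a) := by
  have h := eq_top_of_gen_mul_mem (LinearMap.eqLocus (component M 0)
    ((Algebra.linearMap k _) ∘ₗ (aug M).toLinearMap)) (by simp [component_apply]) (by
      intro i b _; simp [component_zero_gen_mul])
  exact (h ▸ Submodule.mem_top : a ∈ LinearMap.eqLocus (component M 0)
    ((Algebra.linearMap k _) ∘ₗ (aug M).toLinearMap))

/-- Asking for all `m ≥ N` makes the property stable under sums. -/
lemma exists_sum_component (M : Matrix (Fin n) (Fin n) k) (a : QuadraticAlg M) :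
    ∃ N, ∀ m, N ≤ m → ∑ d ∈ Finset.range m, component M d a = a := by
  let S : Submodule k (QuadraticAlg M) :=
    { carrier := {a | ∃ N, ∀ m, N ≤ m → ∑ d ∈ Finset.range m, component M d a = a}
      zero_mem' := ⟨0, by simp⟩
      add_mem' := by
        rintro a b ⟨N, hN⟩ ⟨N', hN'⟩
        refine ⟨max N N', fun m hm => ?_⟩
        simp only [map_add, Finset.sum_add_distrib]
        rw [hN m (le_of_max_le_left hm), hN' m (le_of_max_le_right hm)]
      smul_mem' := by
        rintro c a ⟨N, hN⟩
        refine ⟨N, fun m hm => ?_⟩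
        simp only [map_smul, ← Finset.smul_sum]
        rw [hN m hm] }
  have h : S = ⊤ := by
    refine eq_top_of_gen_mul_mem S ⟨1, ?_⟩ ?_
    · rintro (_ | m) hm
      · simp at hm
      · rw [Finset.sum_range_succ']
        simp [component_apply, Polynomial.coeff_one]
    · rintro i b ⟨N, hN⟩
      refine ⟨N + 1, ?_⟩
      rintro (_ | m) hm
      · simp at hm
      · rw [Finset.sum_range_succ']
        simp only [component_succ_gen_mul, component_zero_gen_mul, add_zero, ← Finset.mul_sum]
        rw [hN m (by omega)]
  exact (h ▸ Submodule.mem_top : a ∈ S)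

lemma exists_sum_mul_gen {M : Matrix (Fin n) (Fin n) k} {a : QuadraticAlg M}
    (ha : aug M a = 0) : ∃ b : Fin n → QuadraticAlg M, a = ∑ i, b i * gen M i := by
  let J : Submodule k (QuadraticAlg M) :=
    { carrier := {a | ∃ b : Fin n → QuadraticAlg M, a = ∑ i, b i * gen M i}
      zero_mem' := ⟨0, by simp⟩
      add_mem' := by
        rintro _ _ ⟨b, rfl⟩ ⟨c, rfl⟩
        exact ⟨b + c, by simp [add_mul, Finset.sum_add_distrib]⟩
      smul_mem' := by
        rintro c _ ⟨b, rfl⟩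
        exact ⟨c • b, by simp [Finset.smul_sum]⟩ }
  have h := eq_top_of_mul_gen_mem
    (J.comap (LinearMap.id - (Algebra.linearMap k _) ∘ₗ (aug M).toLinearMap))
    (by simp) (by
      intro i b _
      exact ⟨Pi.single i b, by simp [Pi.single_apply, ite_mul]⟩)
  have h' := (h ▸ Submodule.mem_top : a ∈ J.comap (LinearMap.id -
    (Algebra.linearMap k _) ∘ₗ (aug M).toLinearMap))
  rw [Submodule.mem_comap] at h'
  simp only [LinearMap.sub_apply, LinearMap.id_apply, LinearMap.comp_apply,
    AlgHom.toLinearMap_apply, ha, map_zero, sub_zero] at h'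
  exact h'

/-- In degree `d > 0`, each term of `∑ e_p * e_q` with `p + q = d` has `p < d` or `q < d`, so it
vanishes by induction. -/
lemma eq_zero_of_idempotent {M : Matrix (Fin n) (Fin n) k} {e : QuadraticAlg M}
    (he : e * e = e) (h0 : aug M e = 0) : e = 0 := by
  have h : ∀ d, component M d e = 0 := by
    intro d
    induction d using Nat.strong_induction_on with
    | _ d ih =>
      rcases Nat.eq_zero_or_pos d with rfl | hd
      · rw [component_zero, h0, map_zero]
      · rw [← he, component_apply, map_mul, Polynomial.coeff_mul]
        refine Finset.sum_eq_zero fun p hp => ?_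
        rw [Finset.HasAntidiagonal.mem_antidiagonal] at hp
        rcases Nat.lt_or_ge p.1 d with h1 | h1
        · have := ih p.1 h1
          rw [component_apply] at this
          rw [this, zero_mul]
        · have := ih p.2 (by omega)
          rw [component_apply] at this
          rw [this, mul_zero]
  obtain ⟨N, hN⟩ := exists_sum_component M e
  rw [← hN N le_rfl]
  exact Finset.sum_eq_zero fun d _ => h d

/-! ### Fox calculus over `A` and the role of the global dimension. -/

/-- Fox derivatives: a left linear relation among the generators also holds between elements of
a module which satisfy the linearised defining relation. -/
lemma sum_smul_eq_zero {M : Matrix (Fin n) (Fin n) k} {Q : Type*} [AddCommGroup Q] [Module k Q]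
    [Module (QuadraticAlg M) Q] [IsScalarTower k (QuadraticAlg M) Q] (E : Fin n → Q)
    (hE : ∑ j, col M j • E j = 0) {a : Fin n → QuadraticAlg M}
    (ha : ∑ j, a j * gen M j = 0) : ∑ j, a j • E j = 0 := by
  -- An extension of the trivial module `k` by `Q`, with `x_i` sending `(0, 1)` to `(E i, 0)`; `hE`
  -- is what makes the relation act as zero.
  let g (i : Fin n) : Module.End k (Q × k) :=
    LinearMap.prod (LinearMap.coprod (Module.toModuleEnd k Q (gen M i))
      (LinearMap.toSpanSingleton k Q (E i))) 0
  have hg_apply (i : Fin n) (p : Q × k) : g i p = (gen M i • p.1 + p.2 • E i, 0) := rfl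
  have hg : ∑ i, ∑ j, M i j • (g i * g j) = 0 := by
    refine LinearMap.ext fun ⟨q, c⟩ => ?_
    have h1 (i j : Fin n) : (M i j • (g i * g j)) (q, c) =
        ((M i j • (gen M i * gen M j)) • q + c • ((M i j • gen M i) • E j), 0) := by
      rw [LinearMap.smul_apply, Module.End.mul_apply, hg_apply, hg_apply]
      simp only [zero_smul, add_zero, Prod.smul_mk, smul_zero, smul_add, mul_smul, smul_assoc]
      rw [smul_comm (gen M i) c, smul_comm (M i j) c]
    simp only [LinearMap.sum_apply, h1, LinearMap.zero_apply]
    refine Prod.ext ?_ (by simp [Prod.snd_sum])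
    simp only [Prod.fst_sum, Prod.fst_zero, Finset.sum_add_distrib, ← Finset.sum_smul,
      sum_gen_mul_gen, zero_smul, zero_add]
    rw [Finset.sum_comm]
    simp only [← Finset.smul_sum, ← Finset.sum_smul]
    change c • ∑ j, col M j • E j = 0
    rw [hE, smul_zero]
  let Φ := lift M g hg
  have hΦ_gen (i : Fin n) : Φ (gen M i) = g i := lift_gen ..
  have hΦ (b : QuadraticAlg M) (q : Q) : Φ b (q, 0) = (b • q, 0) := by
    let S : Submodule k (QuadraticAlg M) :=
      { carrier := {b | ∀ q : Q, Φ b (q, 0) = (b • q, 0)}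
        zero_mem' := by intro q; rw [map_zero, zero_smul]; rfl
        add_mem' := by
          intro a b ha hb q
          rw [map_add, LinearMap.add_apply, ha q, hb q, add_smul, Prod.mk_add_mk, add_zero]
        smul_mem' := by
          intro c a ha q
          rw [map_smul, LinearMap.smul_apply, ha q, smul_assoc, Prod.smul_mk, smul_zero] }
    have hS : S = ⊤ := by
      refine eq_top_of_gen_mul_mem S ?_ fun i b hb q => ?_
      · intro q; rw [map_one, one_smul]; rfl
      · rw [map_mul, Module.End.mul_apply, hb q, hΦ_gen, hg_apply, zero_smul, add_zero, mul_smul]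
    exact (hS ▸ Submodule.mem_top : b ∈ S) q
  have h3 : Φ (∑ j, a j * gen M j) (0, 1) = (∑ j, a j • E j, 0) := by
    simp only [map_sum, map_mul, LinearMap.sum_apply, Module.End.mul_apply, hΦ_gen, hg_apply,
      smul_zero, zero_add, one_smul, hΦ]
    exact Prod.ext (by simp [Prod.fst_sum]) (by simp [Prod.snd_sum])
  rw [ha, map_zero] at h3
  exact (congrArg Prod.fst h3).symm

lemma sum_smul_mk_single {S : Type*} [Ring S] (N : Submodule S (Fin n → S)) (a : Fin n → S) :
    ∑ j, a j • N.mkQ (Pi.single j 1) = N.mkQ a := by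
  simp only [← map_smul, ← map_sum]
  congr 1
  ext j
  simp [Finset.sum_apply, Pi.single_apply]

/-- A left linear relation among the generators is a multiple of the defining relation. -/
lemma exists_eq_mul_col {M : Matrix (Fin n) (Fin n) k} {a : Fin n → QuadraticAlg M}
    (ha : ∑ j, a j * gen M j = 0) : ∃ b, ∀ j, a j = b * col M j := by
  let N : Submodule (QuadraticAlg M) (Fin n → QuadraticAlg M) := Submodule.span _ {col M}
  -- The universal case: the free module modulo the linearised relation, with the basis classes as
  -- `E`.
  have h := sum_smul_eq_zero (fun j => N.mkQ (Pi.single j 1)) (by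
    rw [sum_smul_mk_single, Submodule.mkQ_apply, Submodule.Quotient.mk_eq_zero]
    exact Submodule.mem_span_singleton_self _) ha
  rw [sum_smul_mk_single, Submodule.mkQ_apply, Submodule.Quotient.mk_eq_zero,
    Submodule.mem_span_singleton] at h
  obtain ⟨b, rfl⟩ := h
  exact ⟨b, fun j => rfl⟩

lemma hasProjectiveDimensionLT_ker {S : Type u} [Ring S] {P X : Type u} [AddCommGroup P]
    [AddCommGroup X] [Module S P] [Module S X] [Module.Projective S P] (f : P →ₗ[S] X)
    (hf : Function.Surjective f) (m : ℕ)
    (h : HasProjectiveDimensionLT (ModuleCat.of S X) (m + 2)) :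
    HasProjectiveDimensionLT (ModuleCat.of S (LinearMap.ker f)) (m + 1) := by
  let T : ShortComplex (ModuleCat.{u} S) :=
    ShortComplex.mk (ModuleCat.ofHom (LinearMap.ker f).subtype) (ModuleCat.ofHom f) (by
      ext x; exact x.2)
  have hT : T.ShortExact :=
    { exact := (ShortComplex.moduleCat_exact_iff T).2 fun x hx => ⟨⟨x, hx⟩, rfl⟩
      mono_f := (ModuleCat.mono_iff_injective _).2 Subtype.val_injective
      epi_g := (ModuleCat.epi_iff_surjective _).2 hf }
  have hP : Projective T.X₂ := (IsProjective.iff_projective P).1 inferInstance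
  exact (hT.hasProjectiveDimensionLT_X₃_iff m hP).1 h

/-- If the global dimension is at most two, the defining relation has trivial left annihilator. -/
lemma eq_zero_of_mul_col {M : Matrix (Fin n) (Fin n) k} (hM0 : M ≠ 0)
    (hgd : globalDimension (QuadraticAlg M) ≤ 2) {a : QuadraticAlg M}
    (ha : ∀ j, a * col M j = 0) : a = 0 := by
  let : Module (QuadraticAlg M) k := Module.compHom k (aug M).toRingHom
  have hsmul (b : QuadraticAlg M) (c : k) : b • c = aug M b * c := rfl
  have hk : HasProjectiveDimensionLT (ModuleCat.of (QuadraticAlg M) k) (1 + 2) := by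
    rw [← projectiveDimension_lt_iff]
    refine lt_of_le_of_lt ((le_iSup (fun X : ModuleCat.{u} (QuadraticAlg M) =>
      projectiveDimension X) _).trans hgd) ?_
    exact_mod_cast (by norm_num : (2 : ℕ) < 1 + 2)
  let e0 : QuadraticAlg M →ₗ[QuadraticAlg M] k := LinearMap.toSpanSingleton _ _ 1
  have he0 (b : QuadraticAlg M) : e0 b = aug M b := by simp [e0, hsmul]
  have h1 := hasProjectiveDimensionLT_ker e0 (fun c => ⟨algebraMap k _ c, by simp [he0]⟩) 1 hk
  let d1 : (Fin n → QuadraticAlg M) →ₗ[QuadraticAlg M] LinearMap.ker e0 :=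
    LinearMap.codRestrict _ (Fintype.linearCombination (QuadraticAlg M) (gen M)) (by
      intro z
      simp [he0, Fintype.linearCombination_apply])
  have hd1 (z) : (d1 z : QuadraticAlg M) = ∑ j, z j * gen M j := rfl
  have h2 := hasProjectiveDimensionLT_ker d1 (by
    rintro ⟨b, hb⟩
    rw [LinearMap.mem_ker, he0] at hb
    obtain ⟨z, rfl⟩ := exists_sum_mul_gen hb
    exact ⟨z, rfl⟩) 0 h1
  have h3 : Module.Projective (QuadraticAlg M) (LinearMap.ker d1) :=
    (IsProjective.iff_projective _).2 (projective_iff_hasProjectiveDimensionLT_one.2 h2)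
  have hcol : d1 (col M) = 0 := by
    refine Subtype.ext ?_
    rw [hd1]
    have := sum_gen_mul_gen M
    rw [Finset.sum_comm] at this
    simpa [col, Finset.sum_mul] using this
  let d2 : QuadraticAlg M →ₗ[QuadraticAlg M] LinearMap.ker d1 :=
    LinearMap.toSpanSingleton _ _ ⟨col M, hcol⟩
  have hd2 (b : QuadraticAlg M) (j) : (d2 b).1 j = b * col M j := rfl
  -- The second syzygy of `k` is projective and generated by `col M`, so `d2` splits and the
  -- annihilator of `col M` is generated by the idempotent `e` below.
  obtain ⟨s, hs⟩ := Module.projective_lifting_property d2 LinearMap.id (by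
    rintro ⟨z, hz⟩
    obtain ⟨b, hb⟩ := exists_eq_mul_col (a := z) (by
      rw [← hd1, LinearMap.mem_ker.1 hz]; rfl)
    exact ⟨b, Subtype.ext (funext fun j => (hb j).symm)⟩)
  let e : QuadraticAlg M := 1 - s (d2 1)
  have hker (b : QuadraticAlg M) (hb : ∀ j, b * col M j = 0) : b * e = b := by
    have : d2 b = 0 := Subtype.ext (funext hb)
    rw [mul_sub, mul_one, ← smul_eq_mul b (s _), ← map_smul, ← map_smul, smul_eq_mul, mul_one,
      this, map_zero, sub_zero]
  have he (j) : e * col M j = 0 := by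
    have h : d2 e = 0 := by
      rw [map_sub, ← LinearMap.comp_apply, hs, LinearMap.id_apply, sub_self]
    rw [← hd2, h]; rfl
  have hee := hker e he
  have haug : aug M e = 0 := by
    obtain ⟨i, j, hij⟩ : ∃ i j, M i j ≠ 0 := by
      by_contra! h
      exact hM0 (Matrix.ext h)
    -- The linear part of `e * col M j = 0` is `aug M e • M i j = 0` at `x_i`.
    have h := congrArg (toDual M (Pi.single i 1)) (he j)
    rw [map_mul, toDual_col, map_zero] at h
    have h' := congrArg TrivSqZeroExt.snd h
    simpa [fst_toDual, hij] using h'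
  rw [← hker a ha, eq_zero_of_idempotent hee haug, mul_zero]

/-! ### The enveloping algebra and derivations into bimodules. -/

section Env

variable {A : Type u} [Ring A] [Algebra k A]

/-- The anti-automorphism `a ⊗ op b ↦ b ⊗ op a` of the enveloping algebra. -/
def swap : Env k A →ₗ[k] Env k A :=
  TensorProduct.lift (LinearMap.mk₂ k (fun (a : A) (b : Aᵐᵒᵖ) => b.unop ⊗ₜ[k] MulOpposite.op a)
    (by intros; simp [TensorProduct.tmul_add]) (by intros; simp)
    (by intros; simp [TensorProduct.add_tmul]) (by intros; simp [TensorProduct.smul_tmul']))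

@[simp]
lemma swap_tmul (a : A) (b : Aᵐᵒᵖ) :
    swap (a ⊗ₜ[k] b) = b.unop ⊗ₜ[k] MulOpposite.op a := rfl

@[simp]
lemma swap_swap (w : Env k A) : swap (swap w) = w := by
  induction w using TensorProduct.induction_on with
  | zero => simp
  | tmul a b => simp
  | add x y hx hy => simp [hx, hy]

lemma swap_mul (w v : Env k A) : swap (w * v) = swap v * swap w := by
  induction w using TensorProduct.induction_on with
  | zero => simp
  | add x y hx hy => simp [add_mul, mul_add, hx, hy]
  | tmul a b =>
    induction v using TensorProduct.induction_on with
    | zero => simp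
    | add x y hx hy => rw [mul_add, map_add, map_add, add_mul, hx, hy]
    | tmul c d => simp [Algebra.TensorProduct.tmul_mul_tmul]

/-- The multiplication map `a ⊗ op b ↦ a * b`. -/
def mulMap : Env k A →ₗ[k] A :=
  TensorProduct.lift (LinearMap.mk₂ k (fun (a : A) (b : Aᵐᵒᵖ) => a * b.unop)
    (by intros; simp [add_mul]) (by intros; simp)
    (by intros; simp [mul_add]) (by intros; simp))

@[simp]
lemma mulMap_tmul (a : A) (b : Aᵐᵒᵖ) : mulMap (a ⊗ₜ[k] b) = a * b.unop := rfl

lemma mulMap_tmul_mul (a b : A) (w : Env k A) :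
    mulMap ((a ⊗ₜ[k] MulOpposite.op b) * w) = a * mulMap w * b := by
  induction w using TensorProduct.induction_on with
  | zero => simp
  | add x y hx hy => simp [mul_add, add_mul, hx, hy]
  | tmul c d => simp [Algebra.TensorProduct.tmul_mul_tmul, mul_assoc]

/-- `a ⊗ 1 - 1 ⊗ op a`. -/
def diff (a : A) : Env k A := a ⊗ₜ[k] 1 - 1 ⊗ₜ[k] MulOpposite.op a

variable (k A) in
/-- The map `a ↦ 1 ⊗ op a`. -/
def inclR : A →ₗ[k] Env k A :=
  (TensorProduct.mk k A Aᵐᵒᵖ 1) ∘ₗ (MulOpposite.opLinearEquiv k).toLinearMap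

lemma inclR_apply (a : A) : inclR k A a = 1 ⊗ₜ MulOpposite.op a := rfl

variable (k A) in
/-- `diff` as a linear map. -/
def diffₗ : A →ₗ[k] Env k A :=
  Algebra.TensorProduct.includeLeft.toLinearMap - inclR k A

lemma diffₗ_apply (a : A) : diffₗ k A a = diff a := rfl

lemma env_mul_neg (w v : Env k A) : w * -v = -(w * v) := mul_neg w v

lemma env_neg_mul (w v : Env k A) : -w * v = -(w * v) := neg_mul w v

lemma swap_diff (a : A) : swap (diff a : Env k A) = -diff a := by
  simp [diff]

lemma tmul_mul_diff (a x : A) (b : Aᵐᵒᵖ) : (a ⊗ₜ[k] b) * diff x =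
    (a * x) ⊗ₜ[k] b - a ⊗ₜ[k] MulOpposite.op (x * b.unop) := by
  simp [diff, mul_sub, Algebra.TensorProduct.tmul_mul_tmul]

lemma mulMap_mul_diff (w : Env k A) (x : A) : mulMap (w * diff x) = 0 := by
  induction w using TensorProduct.induction_on with
  | zero => simp
  | add x y hx hy => simp [add_mul, hx, hy]
  | tmul a b => rw [tmul_mul_diff]; simp [mul_assoc]

lemma diff_mul (a b : A) : (diff (a * b) : Env k A) =
    (1 ⊗ₜ[k] MulOpposite.op b) * diff a + (a ⊗ₜ[k] 1) * diff b := by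
  rw [tmul_mul_diff, tmul_mul_diff, one_mul, MulOpposite.unop_op, MulOpposite.unop_one, mul_one,
    diff]
  abel

variable {M : Matrix (Fin n) (Fin n) k} {x : Fin n → A}

/-- In `diff (x i) * diff (x j)` the mixed terms are symmetric in `i, j` and cancel against `M`
without dividing by 2; the pure terms give the relation in the left factor and its negative in the
right one. -/
lemma sum_diff_mul_diff (hanti : M.transpose = -M) (hx : ∑ i, ∑ j, M i j • (x i * x j) = 0) :
    ∑ j, (∑ i, M i j • (diff (x i) : Env k A)) * diff (x j) = 0 := by
  have hM (i j : Fin n) : M j i = - M i j := congrFun (congrFun hanti i) j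
  have h (i j : Fin n) : (diff (x i) : Env k A) * diff (x j) =
      (x i * x j) ⊗ₜ 1 + 1 ⊗ₜ MulOpposite.op (x j * x i)
        - (x i ⊗ₜ MulOpposite.op (x j) + x j ⊗ₜ MulOpposite.op (x i)) := by
    simp only [diff, sub_mul, mul_sub, Algebra.TensorProduct.tmul_mul_tmul, one_mul, mul_one,
      ← MulOpposite.op_mul]
    abel
  simp only [Finset.sum_mul, smul_mul_assoc, h, smul_sub, smul_add,
    Finset.sum_sub_distrib, Finset.sum_add_distrib]
  have h1 : ∑ j, ∑ i, M i j • ((x i * x j) ⊗ₜ[k] (1 : Aᵐᵒᵖ)) = 0 := by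
    rw [Finset.sum_comm]
    have h := congrArg (Algebra.TensorProduct.includeLeft : A →ₐ[k] Env k A).toLinearMap hx
    simp only [map_sum, map_smul, map_zero] at h
    exact h
  have h2 : ∑ j, ∑ i, M i j • ((1 : A) ⊗ₜ[k] MulOpposite.op (x j * x i)) = 0 := by
    have : ∑ j, ∑ i, M i j • (x j * x i) = 0 := by
      rw [← neg_eq_zero, ← hx, ← Finset.sum_neg_distrib]
      refine Finset.sum_congr rfl fun j _ => ?_
      rw [← Finset.sum_neg_distrib]
      exact Finset.sum_congr rfl fun i _ => by
        rw [hM j i, neg_smul (M j i) (x j * x i), neg_neg]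
    have h := congrArg (inclR k A) this
    simp only [map_sum, map_smul, map_zero] at h
    exact h
  have h3 : ∑ j, ∑ i, M i j • (x j ⊗ₜ[k] MulOpposite.op (x i)) =
      - ∑ j, ∑ i, M i j • (x i ⊗ₜ[k] MulOpposite.op (x j)) := by
    rw [Finset.sum_comm, eq_neg_iff_add_eq_zero, ← Finset.sum_add_distrib]
    refine Finset.sum_eq_zero fun i _ => ?_
    rw [← Finset.sum_add_distrib]
    refine Finset.sum_eq_zero fun j _ => ?_
    rw [hM j i, ← add_smul, neg_add_cancel]
    exact zero_smul ..
  rw [h1, h2, h3]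
  simp

variable {Q : Type*} [AddCommGroup Q] [Module k Q] [Module (Env k A) Q]
  [IsScalarTower k (Env k A) Q]

/-- The endomorphism `(q, a) ↦ (b * q + e * a, b * a)` attached to a generator `b` and the value `e`
of a bimodule derivation at `b`. -/
def derivEnd (b : A) (e : Q) : Module.End k (Q × A) :=
  LinearMap.prod (LinearMap.coprod (Module.toModuleEnd k Q (b ⊗ₜ[k] (1 : Aᵐᵒᵖ)))
    ((LinearMap.toSpanSingleton (Env k A) Q e).restrictScalars k ∘ₗ inclR k A))
    (LinearMap.mulLeft k b ∘ₗ LinearMap.snd k _ _)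

lemma derivEnd_apply (b : A) (e : Q) (p : Q × A) : derivEnd (k := k) b e p =
    ((b ⊗ₜ[k] (1 : Aᵐᵒᵖ)) • p.1 + inclR k A p.2 • e, b * p.2) := rfl

lemma derivEnd_mul_apply (b b' : A) (e e' : Q) (q : Q) (a : A) :
    (derivEnd (k := k) b e * derivEnd (k := k) b' e') (q, a) =
      (((b * b') ⊗ₜ[k] (1 : Aᵐᵒᵖ)) • q + inclR k A a • ((b ⊗ₜ[k] (1 : Aᵐᵒᵖ)) • e' +
        inclR k A b' • e), (b * b') * a) := by
  rw [Module.End.mul_apply, derivEnd_apply, derivEnd_apply]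
  refine Prod.ext ?_ (mul_assoc ..).symm
  simp only [smul_add, smul_smul, inclR_apply, Algebra.TensorProduct.tmul_mul_tmul, one_mul,
    mul_one, MulOpposite.op_mul, add_assoc]

/-- The Leibniz terms are `M i j • (x_i E_j + E_i x_j)`. Exchanging the indices in the second half
and using antisymmetry collects them into the sum in `hE`. -/
lemma sum_derivEnd (hanti : M.transpose = -M) (hx : ∑ i, ∑ j, M i j • (x i * x j) = 0)
    {E : Fin n → Q} (hE : ∑ j, (∑ i, M i j • (diff (x i) : Env k A)) • E j = 0) :
    ∑ i, ∑ j, M i j • (derivEnd (k := k) (x i) (E i) * derivEnd (k := k) (x j) (E j)) = 0 := by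
  have hM (i j : Fin n) : M j i = - M i j := congrFun (congrFun hanti i) j
  refine LinearMap.ext fun ⟨q, a⟩ => ?_
  simp only [LinearMap.sum_apply, LinearMap.smul_apply, derivEnd_mul_apply, LinearMap.zero_apply]
  refine Prod.ext ?_ ?_
  · simp only [Prod.fst_sum, Prod.smul_fst, Prod.fst_zero, smul_add, Finset.sum_add_distrib]
    have h1 : ∑ i, ∑ j, M i j • ((x i * x j) ⊗ₜ[k] (1 : Aᵐᵒᵖ)) • q = 0 := by
      have h := congrArg (Algebra.TensorProduct.includeLeft : A →ₐ[k] Env k A).toLinearMap hx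
      simp only [map_sum, map_smul, map_zero] at h
      have h' := congrArg (fun w : Env k A => w • q) h
      simp only [Finset.sum_smul, smul_assoc] at h'
      exact h'.trans (zero_smul (Env k A) q)
    have h2 : ∑ i, ∑ j, M i j • inclR k A a • (x i ⊗ₜ[k] (1 : Aᵐᵒᵖ)) • E j +
        ∑ i, ∑ j, M i j • inclR k A a • inclR k A (x j) • E i =
        inclR k A a • ∑ j, (∑ i, M i j • (diff (x i) : Env k A)) • E j := by
      rw [Finset.sum_comm, ← Finset.sum_add_distrib, Finset.smul_sum]
      refine Finset.sum_congr rfl fun j _ => ?_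
      rw [← Finset.sum_add_distrib, Finset.sum_smul, Finset.smul_sum]
      refine Finset.sum_congr rfl fun i _ => ?_
      rw [hM i j, smul_assoc, smul_comm (inclR k A a) (M i j), diff, sub_smul, smul_sub, smul_sub,
        neg_smul (M i j) (inclR k A a • inclR k A (x i) • E j), inclR_apply, inclR_apply,
        sub_eq_add_neg]
    rw [h1, h2, hE, smul_zero, add_zero]
  · simp only [Prod.snd_sum, Prod.smul_snd, Prod.snd_zero, ← smul_mul_assoc (M _ _) (_ * _) a,
      ← Finset.sum_mul, hx, zero_mul]

/-- If a bimodule derivation takes the values `E j` at generators `x j`, then the left linear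
relations among the `x j ⊗ 1 - 1 ⊗ x j` also hold between the `E j`. -/
lemma sum_smul_eq_zero_of_derivEnd {E : Fin n → Q} (Φ : A →ₐ[k] Module.End k (Q × A))
    (hΦ : ∀ i, Φ (x i) = derivEnd (x i) (E i))
    (hind : ∀ S : Submodule k A, 1 ∈ S → (∀ i, ∀ b ∈ S, x i * b ∈ S) → S = ⊤)
    {z : Fin n → Env k A} (hz : ∑ j, z j * diff (x j) = 0) : ∑ j, z j • E j = 0 := by
  have hsnd (b : A) : (Φ b (0, 1)).2 = b := by
    let S : Submodule k A := LinearMap.eqLocus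
      (LinearMap.snd k Q A ∘ₗ LinearMap.applyₗ (0, 1) ∘ₗ Φ.toLinearMap) LinearMap.id
    have hS : S = ⊤ := by
      refine hind S ?_ fun i b hb => ?_
      · change (Φ 1 (0, 1)).2 = 1
        rw [map_one]; rfl
      · replace hb : (Φ b (0, 1)).2 = b := hb
        change (Φ (x i * b) (0, 1)).2 = x i * b
        rw [map_mul, Module.End.mul_apply, hΦ, derivEnd_apply, hb]
    exact (hS ▸ Submodule.mem_top : b ∈ S)
  -- `D` is the derivation with `D (x i) = E i`. The map `Ψ : a ⊗ b ↦ a • D b` then sends `w * diff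
  -- (x i)` to `-(w • E i)`, so it carries the relation `hz` to the goal.
  let D : A →ₗ[k] Q := LinearMap.fst k Q A ∘ₗ LinearMap.applyₗ (0, 1) ∘ₗ Φ.toLinearMap
  have hD (i : Fin n) (b : A) :
      D (x i * b) = (x i ⊗ₜ[k] (1 : Aᵐᵒᵖ)) • D b + inclR k A b • E i := by
    change (Φ (x i * b) (0, 1)).1 = (x i ⊗ₜ[k] (1 : Aᵐᵒᵖ)) • (Φ b (0, 1)).1 + inclR k A b • E i
    rw [map_mul, Module.End.mul_apply, hΦ, derivEnd_apply, hsnd]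
  let Ψ : Env k A →ₗ[k] Q :=
    TensorProduct.lift (LinearMap.mk₂ k
      (fun (a : A) (b : Aᵐᵒᵖ) => (a ⊗ₜ[k] (1 : Aᵐᵒᵖ)) • D b.unop)
      (by intros; rw [TensorProduct.add_tmul, add_smul])
      (by intro c a b; rw [← smul_assoc]; rfl)
      (by intros; rw [MulOpposite.unop_add, map_add, smul_add])
      (by intro c a b; rw [MulOpposite.unop_smul, map_smul, smul_algebra_smul_comm]))
  have hΨ_tmul (a : A) (b : Aᵐᵒᵖ) : Ψ (a ⊗ₜ b) = (a ⊗ₜ[k] (1 : Aᵐᵒᵖ)) • D b.unop := rfl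
  have hΨ (w : Env k A) (i : Fin n) : Ψ (w * diff (x i)) = - (w • E i) := by
    induction w using TensorProduct.induction_on with
    | zero => rw [zero_mul, map_zero, eq_comm, neg_eq_zero]; exact zero_smul (Env k A) (E i)
    | add x y hx hy => rw [add_mul, map_add, hx, hy, add_smul, neg_add]
    | tmul a b =>
      rw [tmul_mul_diff, map_sub, hΨ_tmul, hΨ_tmul, MulOpposite.unop_op, hD, smul_add,
        inclR_apply, smul_smul, smul_smul, Algebra.TensorProduct.tmul_mul_tmul,
        Algebra.TensorProduct.tmul_mul_tmul, MulOpposite.op_unop, mul_one, one_mul, mul_one,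
        sub_add_cancel_left]
  have h := congrArg Ψ hz
  simp only [map_sum, hΨ, map_zero, Finset.sum_neg_distrib, neg_eq_zero] at h
  exact h

end Env

/-! ### Exactness of the bimodule complex, on elements. -/

variable {M : Matrix (Fin n) (Fin n) k}

/-- The element `∑ i, M i j • (x_i ⊗ 1 - 1 ⊗ x_i)`. -/
def diffCol (M : Matrix (Fin n) (Fin n) k) (j : Fin n) : Env k (QuadraticAlg M) :=
  ∑ i, M i j • diff (gen M i)

lemma diffCol_eq (j : Fin n) : diffCol M j = diff (col M j) := by
  simp only [diffCol, ← diffₗ_apply, col, map_sum, map_smul]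

lemma swap_diffCol (j : Fin n) : swap (diffCol M j) = -diffCol M j := by
  rw [diffCol_eq, swap_diff]

lemma sum_diffCol_mul_diff (hanti : M.transpose = -M) :
    ∑ j, diffCol M j * diff (gen M j) = 0 :=
  sum_diff_mul_diff hanti (sum_gen_mul_gen M)

/-- A left linear relation among the `x_i ⊗ 1 - 1 ⊗ x_i` also holds between elements of a module
which satisfy the linearised defining relation. -/
lemma sum_smul_eq_zero_of_env (hanti : M.transpose = -M) {Q : Type*} [AddCommGroup Q] [Module k Q]
    [Module (Env k (QuadraticAlg M)) Q] [IsScalarTower k (Env k (QuadraticAlg M)) Q]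
    (E : Fin n → Q) (hE : ∑ j, diffCol M j • E j = 0) {z : Fin n → Env k (QuadraticAlg M)}
    (hz : ∑ j, z j * diff (gen M j) = 0) : ∑ j, z j • E j = 0 :=
  sum_smul_eq_zero_of_derivEnd
    (lift M (fun i => derivEnd (gen M i) (E i)) (sum_derivEnd hanti (sum_gen_mul_gen M) hE))
    (fun _ => lift_gen ..) eq_top_of_gen_mul_mem hz

lemma exists_eq_mul_diffCol (hanti : M.transpose = -M) {z : Fin n → Env k (QuadraticAlg M)}
    (hz : ∑ j, z j * diff (gen M j) = 0) : ∃ w, ∀ j, z j = w * diffCol M j := by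
  let N : Submodule (Env k (QuadraticAlg M)) (Fin n → Env k (QuadraticAlg M)) :=
    Submodule.span _ {diffCol M}
  have h := sum_smul_eq_zero_of_env hanti (fun j => N.mkQ (Pi.single j 1)) (by
    rw [sum_smul_mk_single, Submodule.mkQ_apply, Submodule.Quotient.mk_eq_zero]
    exact Submodule.mem_span_singleton_self _) hz
  rw [sum_smul_mk_single, Submodule.mkQ_apply, Submodule.Quotient.mk_eq_zero,
    Submodule.mem_span_singleton] at h
  obtain ⟨b, rfl⟩ := h
  exact ⟨b, fun j => rfl⟩

/-- By the Leibniz rule `diff_mul`, the left ideal of the `diff x_j` contains every `diff b`, and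
modulo these `a ⊗ b` equals `a * b ⊗ 1`. -/
lemma exists_eq_sum_mul_diff {w : Env k (QuadraticAlg M)} (hw : mulMap w = 0) :
    ∃ z : Fin n → Env k (QuadraticAlg M), w = ∑ j, z j * diff (gen M j) := by
  let J : Submodule (Env k (QuadraticAlg M)) (Env k (QuadraticAlg M)) :=
    Submodule.span _ (Set.range fun j => diff (gen M j))
  have hJ (b : QuadraticAlg M) : (diff b : Env k (QuadraticAlg M)) ∈ J := by
    have hS := eq_top_of_gen_mul_mem ((J.restrictScalars k).comap (diffₗ k _)) (by
      change diff 1 ∈ J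
      have : (diff 1 : Env k (QuadraticAlg M)) = 0 := by simp [diff]
      rw [this]; exact J.zero_mem) (by
      intro i b hb
      change diff (gen M i * b) ∈ J
      have hb' : diff b ∈ J := hb
      rw [diff_mul]
      exact J.add_mem (J.smul_mem _ (Submodule.subset_span ⟨i, rfl⟩)) (J.smul_mem _ hb'))
    exact (hS ▸ Submodule.mem_top : b ∈ (J.restrictScalars k).comap (diffₗ k _))
  have key (w : Env k (QuadraticAlg M)) : mulMap w ⊗ₜ[k] 1 - w ∈ J := by
    induction w using TensorProduct.induction_on with
    | zero => simp
    | add x y hx hy =>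
      rw [map_add, TensorProduct.add_tmul]
      convert J.add_mem hx hy using 1
      exact add_sub_add_comm ..
    | tmul a b =>
      have h : mulMap (a ⊗ₜ[k] b) ⊗ₜ[k] 1 - a ⊗ₜ[k] b =
          (a ⊗ₜ[k] (1 : (QuadraticAlg M)ᵐᵒᵖ)) * diff b.unop := by
        rw [tmul_mul_diff]; simp
      rw [h]
      exact J.smul_mem _ (hJ _)
  have h := key w
  rw [hw, TensorProduct.zero_tmul] at h
  replace h := J.neg_mem h
  rw [neg_sub, sub_zero, Submodule.mem_span_range_iff_exists_fun]
    at h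
  obtain ⟨z, rfl⟩ := h
  exact ⟨z, rfl⟩

/-- The coordinates of `w` in a `k`-basis of the second factor are each annihilated by every `y j`.
-/
lemma eq_zero_of_mul_tmul_one {A : Type u} [Ring A] [Algebra k A] {ι : Type*} (y : ι → A)
    (hy : ∀ a : A, (∀ j, a * y j = 0) → a = 0) {w : Env k A}
    (hw : ∀ j, w * (y j ⊗ₜ[k] 1) = 0) : w = 0 := by
  let T (φ : Aᵐᵒᵖ →ₗ[k] k) : Env k A →ₗ[k] A := TensorProduct.rid k A ∘ₗ LinearMap.lTensor A φ
  have hT (φ) (v : Env k A) (x : A) : T φ (v * (x ⊗ₜ[k] 1)) = T φ v * x := by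
    induction v using TensorProduct.induction_on with
    | zero => simp
    | add x y hx hy => rw [add_mul, map_add, map_add, add_mul, hx, hy]
    | tmul a b => simp [T, Algebra.TensorProduct.tmul_mul_tmul]
  have h0 (φ) : T φ w = 0 := hy _ fun j => by rw [← hT, hw, map_zero]
  let b := Module.Free.chooseBasis k Aᵐᵒᵖ
  have hsum : ∀ v : Env k A, ∃ s : Finset (Module.Free.ChooseBasisIndex k Aᵐᵒᵖ),
      ∀ t, s ⊆ t → v = ∑ i ∈ t, T (b.coord i) v ⊗ₜ[k] b i := by
    intro v
    classical
    induction v using TensorProduct.induction_on with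
    | zero => exact ⟨∅, by simp⟩
    | add x y hx hy =>
      obtain ⟨s, hs⟩ := hx
      obtain ⟨s', hs'⟩ := hy
      refine ⟨s ∪ s', fun t ht => ?_⟩
      simp only [map_add, TensorProduct.add_tmul, Finset.sum_add_distrib]
      rw [← hs t (Finset.union_subset_left ht), ← hs' t (Finset.union_subset_right ht)]
    | tmul a c =>
      refine ⟨(b.repr c).support, fun t ht => ?_⟩
      simp only [T, LinearMap.comp_apply, LinearMap.lTensor_tmul, LinearEquiv.coe_coe,
        TensorProduct.rid_tmul, Module.Basis.coord_apply, TensorProduct.smul_tmul,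
        ← TensorProduct.tmul_sum]
      congr 1
      conv_lhs => rw [← b.linearCombination_repr c, Finsupp.linearCombination_apply]
      exact Finsupp.sum_of_support_subset _ ht _ (by simp)
  obtain ⟨s, hs⟩ := hsum w
  rw [hs s subset_rfl]
  simp [h0]

/-- The projection onto the component of degree `d` in the second tensor factor. -/
def rightComponent (M : Matrix (Fin n) (Fin n) k) (d : ℕ) :
    Env k (QuadraticAlg M) →ₗ[k] Env k (QuadraticAlg M) :=
  LinearMap.lTensor _ ((MulOpposite.opLinearEquiv k).toLinearMap ∘ₗ component M d ∘ₗ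
    (MulOpposite.opLinearEquiv k).symm.toLinearMap)

lemma rightComponent_tmul (d : ℕ) (a : QuadraticAlg M) (b : (QuadraticAlg M)ᵐᵒᵖ) :
    rightComponent M d (a ⊗ₜ b) = a ⊗ₜ MulOpposite.op (component M d b.unop) := rfl

lemma component_zero_col_mul (j : Fin n) (a : QuadraticAlg M) :
    component M 0 (col M j * a) = 0 := by
  simp [col, Finset.sum_mul, component_zero_gen_mul]

lemma component_succ_col_mul (d : ℕ) (j : Fin n) (a : QuadraticAlg M) :
    component M (d + 1) (col M j * a) = col M j * component M d a := by
  simp [col, Finset.sum_mul, component_succ_gen_mul]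

/-- The hypothesis reads `w * (col ⊗ 1) = w * (1 ⊗ col)`. The left side preserves the degree in the
second factor and the right side raises it by one, so the components of `w` vanish successively. -/
lemma eq_zero_of_mul_diffCol (hM0 : M ≠ 0) (hgd : globalDimension (QuadraticAlg M) ≤ 2)
    {w : Env k (QuadraticAlg M)} (hw : ∀ j, w * diffCol M j = 0) : w = 0 := by
  have hl (d) (v : Env k (QuadraticAlg M)) (y) :
      rightComponent M d (v * (y ⊗ₜ[k] 1)) = rightComponent M d v * (y ⊗ₜ[k] 1) := by
    induction v using TensorProduct.induction_on with
    | zero => simp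
    | add x y hx hy => rw [add_mul, map_add, map_add, add_mul, hx, hy]
    | tmul a b => simp [rightComponent_tmul, Algebra.TensorProduct.tmul_mul_tmul]
  have hr0 (v : Env k (QuadraticAlg M)) (j) :
      rightComponent M 0 (v * (1 ⊗ₜ[k] MulOpposite.op (col M j))) = 0 := by
    induction v using TensorProduct.induction_on with
    | zero => simp
    | add x y hx hy => rw [add_mul, map_add, hx, hy, add_zero]
    | tmul a b =>
      simp [rightComponent_tmul, Algebra.TensorProduct.tmul_mul_tmul, component_zero_col_mul]
  have hr (d) (v : Env k (QuadraticAlg M)) (j) :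
      rightComponent M (d + 1) (v * (1 ⊗ₜ[k] MulOpposite.op (col M j))) =
        rightComponent M d v * (1 ⊗ₜ[k] MulOpposite.op (col M j)) := by
    induction v using TensorProduct.induction_on with
    | zero => simp
    | add x y hx hy => rw [add_mul, map_add, map_add, add_mul, hx, hy]
    | tmul a b =>
      simp [rightComponent_tmul, Algebra.TensorProduct.tmul_mul_tmul, component_succ_col_mul]
  have hw' (j) : w * (col M j ⊗ₜ[k] 1) = w * (1 ⊗ₜ[k] MulOpposite.op (col M j)) := by
    have h := hw j
    rwa [diffCol_eq, diff, mul_sub, sub_eq_zero] at h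
  have h0 (d : ℕ) : rightComponent M d w = 0 := by
    induction d with
    | zero =>
      refine eq_zero_of_mul_tmul_one (col M) (fun a => eq_zero_of_mul_col hM0 hgd) fun j => ?_
      rw [← hl, hw', hr0]
    | succ d ih =>
      refine eq_zero_of_mul_tmul_one (col M) (fun a => eq_zero_of_mul_col hM0 hgd) fun j => ?_
      rw [← hl, hw', hr, ih, zero_mul]
  have hsum : ∀ v : Env k (QuadraticAlg M), ∃ N, ∀ m, N ≤ m →
      ∑ d ∈ Finset.range m, rightComponent M d v = v := by
    intro v
    induction v using TensorProduct.induction_on with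
    | zero => exact ⟨0, by simp⟩
    | add x y hx hy =>
      obtain ⟨N, hN⟩ := hx
      obtain ⟨N', hN'⟩ := hy
      refine ⟨max N N', fun m hm => ?_⟩
      simp only [map_add, Finset.sum_add_distrib]
      rw [hN m (le_of_max_le_left hm), hN' m (le_of_max_le_right hm)]
    | tmul a b =>
      obtain ⟨N, hN⟩ := exists_sum_component M b.unop
      refine ⟨N, fun m hm => ?_⟩
      simp only [rightComponent_tmul, ← TensorProduct.tmul_sum]
      congr 1
      exact (map_sum (MulOpposite.opLinearEquiv k) _ _).symm.trans (congrArg _ (hN m hm))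
  obtain ⟨N, hN⟩ := hsum w
  rw [← hN N le_rfl]
  exact Finset.sum_eq_zero fun d _ => h0 d

/-! ### Splicing resolutions and computing Ext from two short exact sequences. -/

section Abelian

open Limits

universe w v

variable {C : Type w} [Category.{v} C] [Abelian C]

/-- Splicing a projective resolution of the kernel of an epimorphism from a projective object. -/
lemma exists_projectiveResolution_cons {X₁ X₂ X₃ : C} {f : X₁ ⟶ X₂} {g : X₂ ⟶ X₃} {w : f ≫ g = 0}
    (h : (ShortComplex.mk f g w).ShortExact) [Projective X₂] (R : ProjectiveResolution X₁) :
    ∃ P : ProjectiveResolution X₃, P.complex.X 0 = X₂ ∧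
      ∀ i, P.complex.X (i + 1) = R.complex.X i := by
  have : Mono f := h.mono_f
  have : Epi g := h.epi_g
  let π₀ : R.complex.X 0 ⟶ X₁ := R.π.f 0
  have : Epi π₀ := inferInstanceAs (Epi (R.π.f 0))
  have hπ₀ : R.complex.d 1 0 ≫ π₀ = 0 := R.complex_d_comp_π_f_zero
  let K : ChainComplex C ℕ := ChainComplex.augment R.complex (π₀ ≫ f) (by
    rw [← Category.assoc, hπ₀, zero_comp])
  have hK1 : K.d 1 0 = π₀ ≫ f := rfl
  have hw : (π₀ ≫ f) ≫ g = 0 := by rw [Category.assoc, w, comp_zero]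
  have ex0 : (ShortComplex.mk (π₀ ≫ f) g hw).Exact := by
    let φ : ShortComplex.mk (π₀ ≫ f) g hw ⟶
        ShortComplex.mk f g w :=
      { τ₁ := π₀, τ₂ := 𝟙 _, τ₃ := 𝟙 _ }
    have : Epi φ.τ₁ := ‹Epi π₀›
    have : IsIso φ.τ₂ := inferInstanceAs (IsIso (𝟙 X₂))
    have : Mono φ.τ₃ := inferInstanceAs (Mono (𝟙 X₃))
    exact (ShortComplex.exact_iff_of_epi_of_isIso_of_mono φ).2 h.exact
  have ex1 : (ShortComplex.mk (R.complex.d 1 0) (π₀ ≫ f) (by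
      rw [← Category.assoc, hπ₀, zero_comp])).Exact := by
    let φ : ShortComplex.mk (R.complex.d 1 0) π₀ hπ₀ ⟶
        ShortComplex.mk (R.complex.d 1 0) (π₀ ≫ f) (by
          rw [← Category.assoc, hπ₀, zero_comp]) :=
      { τ₁ := 𝟙 _, τ₂ := 𝟙 _, τ₃ := f }
    have : Epi φ.τ₁ := inferInstanceAs (Epi (𝟙 _))
    have : IsIso φ.τ₂ := inferInstanceAs (IsIso (𝟙 _))
    have : Mono φ.τ₃ := ‹Mono f›
    exact (ShortComplex.exact_iff_of_epi_of_isIso_of_mono φ).1 R.exact₀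
  have hexact (m : ℕ) : K.ExactAt (m + 1) := by
    rw [HomologicalComplex.exactAt_iff' _ (m + 1 + 1) (m + 1) m (by simp) (by simp)]
    match m with
    | 0 => exact ex1
    | m + 1 => exact R.exact_succ m
  let π : K ⟶ (ChainComplex.single₀ C).obj X₃ :=
    (ChainComplex.toSingle₀Equiv K X₃).symm ⟨g, hK1 ▸ hw⟩
  have hπ : π.f 0 = g := ChainComplex.toSingle₀Equiv_symm_apply_f_zero ..
  refine ⟨⟨K, ?_, π, ⟨fun m => ?_⟩⟩, rfl, fun _ => rfl⟩
  · rintro (_ | m)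
    · exact ‹Projective X₂›
    · exact R.projective m
  · cases m with
    | zero =>
      rw [ChainComplex.quasiIsoAt₀_iff, ShortComplex.quasiIso_iff_of_zeros']
      · refine (ShortComplex.exact_and_epi_g_iff_of_iso ?_).2 ⟨ex0, ‹Epi g›⟩
        exact ShortComplex.isoMk (Iso.refl _) (Iso.refl _) (Iso.refl _)
          ((Category.id_comp (π₀ ≫ f)).trans (Category.comp_id _).symm)
          ((Category.id_comp g).trans (hπ.symm.trans (Category.comp_id _).symm))
      all_goals rfl
    | succ m =>
      rw [quasiIsoAt_iff_exactAt']
      · exact hexact m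
      · apply ChainComplex.exactAt_succ_single_obj

variable {X₀ X₁ X₂ K X Y : C} {d : X₂ ⟶ X₁} {p : X₁ ⟶ K} {i : K ⟶ X₀} {q : X₀ ⟶ X}
  {w₂ : d ≫ p = 0} {w₁ : i ≫ q = 0}

lemma exists_projectiveResolution_of_shortExact [Projective X₀] [Projective X₁] [Projective X₂]
    (h₂ : (ShortComplex.mk d p w₂).ShortExact) (h₁ : (ShortComplex.mk i q w₁).ShortExact) :
    ∃ P : ProjectiveResolution X, P.complex.X 0 = X₀ ∧ P.complex.X 1 = X₁ ∧
      P.complex.X 2 = X₂ ∧ ∀ m, IsZero (P.complex.X (m + 3)) := by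
  obtain ⟨P, hP0, hP⟩ := exists_projectiveResolution_cons h₂ (ProjectiveResolution.self X₂)
  obtain ⟨P', hP0', hP'⟩ := exists_projectiveResolution_cons h₁ P
  refine ⟨P', hP0', (hP' 0).trans hP0, (hP' 1).trans (hP 0), fun m => ?_⟩
  rw [hP' (m + 2), hP (m + 1)]
  exact HomologicalComplex.isZero_single_obj_X _ _ _ _ (by simp)

lemma hasProjectiveDimensionLT_three [Projective X₀] [Projective X₁] [Projective X₂]
    (h₂ : (ShortComplex.mk d p w₂).ShortExact) (h₁ : (ShortComplex.mk i q w₁).ShortExact) :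
    HasProjectiveDimensionLT X 3 := by
  have hK : HasProjectiveDimensionLT K 2 :=
    (h₂.hasProjectiveDimensionLT_X₃_iff 0 ‹_›).2 (inferInstanceAs (HasProjectiveDimensionLT X₂ 1))
  exact (h₁.hasProjectiveDimensionLT_X₃_iff 1 ‹_›).2 hK

variable [HasExt.{u} C]

open Abelian

/-- `Ext¹(X, Y)` is the cokernel of restriction along `i`, as `X₀` is projective. -/
lemma ext_one_eq_zero [Projective X₀] (h₁ : (ShortComplex.mk i q w₁).ShortExact)
    (H : ∀ φ : K ⟶ Y, ∃ ψ : X₀ ⟶ Y, φ = i ≫ ψ) (ξ : Ext.{u} X Y 1) : ξ = 0 := by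
  obtain ⟨x, rfl⟩ := Ext.contravariant_sequence_exact₃ h₁ Y ξ
    (Ext.eq_zero_of_hasProjectiveDimensionLT _ 1 le_rfl) (show 1 + 0 = 1 from rfl)
  obtain ⟨φ, rfl⟩ := Ext.homEquiv₀.symm.surjective x
  obtain ⟨ψ, rfl⟩ := H φ
  rw [Ext.homEquiv₀_symm_apply, ← Ext.mk₀_comp_mk₀]
  exact h₁.extClass_comp_assoc _

/-- The map from morphisms on the second syzygy to `Ext²`. -/
def toExtTwo (h₂ : (ShortComplex.mk d p w₂).ShortExact) (h₁ : (ShortComplex.mk i q w₁).ShortExact)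
    (Y : C) : (X₂ ⟶ Y) →+ Ext.{u} X Y 2 where
  toFun φ := h₁.extClass.comp (h₂.extClass.comp (Ext.mk₀ φ) (add_zero 1)) (show 1 + 1 = 2 from rfl)
  map_zero' := by simp
  map_add' φ ψ := by simp [Ext.mk₀_add]

lemma toExtTwo_apply (h₂ : (ShortComplex.mk d p w₂).ShortExact)
    (h₁ : (ShortComplex.mk i q w₁).ShortExact) (φ : X₂ ⟶ Y) : toExtTwo h₂ h₁ Y φ =
    h₁.extClass.comp (h₂.extClass.comp (Ext.mk₀ φ) (add_zero 1)) (show 1 + 1 = 2 from rfl) := rfl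

lemma toExtTwo_surjective [Projective X₀] [Projective X₁]
    (h₂ : (ShortComplex.mk d p w₂).ShortExact) (h₁ : (ShortComplex.mk i q w₁).ShortExact) :
    Function.Surjective (toExtTwo h₂ h₁ Y) := by
  intro ξ
  obtain ⟨x, rfl⟩ := Ext.contravariant_sequence_exact₃ h₁ Y ξ
    (Ext.eq_zero_of_hasProjectiveDimensionLT _ 1 (by omega)) (show 1 + 1 = 2 from rfl)
  obtain ⟨y, rfl⟩ := Ext.contravariant_sequence_exact₃ h₂ Y x
    (Ext.eq_zero_of_hasProjectiveDimensionLT _ 1 le_rfl) (show 1 + 0 = 1 from rfl)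
  obtain ⟨φ, rfl⟩ := Ext.homEquiv₀.symm.surjective y
  exact ⟨φ, rfl⟩

/-- Together with surjectivity, this presents `Ext²` as the cokernel of precomposition with `d`. -/
lemma toExtTwo_eq_zero_iff [Projective X₀]
    (h₂ : (ShortComplex.mk d p w₂).ShortExact) (h₁ : (ShortComplex.mk i q w₁).ShortExact)
    (φ : X₂ ⟶ Y) : toExtTwo h₂ h₁ Y φ = 0 ↔ ∃ ψ : X₁ ⟶ Y, φ = d ≫ ψ := by
  rw [toExtTwo_apply]
  constructor
  · intro h
    obtain ⟨x, hx⟩ := Ext.contravariant_sequence_exact₁ h₁ Y _ _ h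
    rw [Ext.eq_zero_of_hasProjectiveDimensionLT x 1 le_rfl, Ext.comp_zero] at hx
    obtain ⟨y, hy⟩ := Ext.contravariant_sequence_exact₁ h₂ Y _ _ hx.symm
    obtain ⟨ψ, rfl⟩ := Ext.homEquiv₀.symm.surjective y
    refine ⟨ψ, ?_⟩
    rw [Ext.homEquiv₀_symm_apply, Ext.mk₀_comp_mk₀] at hy
    exact (Ext.homEquiv₀.symm.injective hy).symm
  · rintro ⟨ψ, rfl⟩
    rw [← Ext.mk₀_comp_mk₀, h₂.extClass_comp_assoc, Ext.comp_zero]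

lemma toExtTwo_comp (h₂ : (ShortComplex.mk d p w₂).ShortExact)
    (h₁ : (ShortComplex.mk i q w₁).ShortExact) {Y' : C} (φ : X₂ ⟶ Y) (v : Y ⟶ Y') :
    (toExtTwo h₂ h₁ Y φ).comp (Ext.mk₀ v) (add_zero 2) = toExtTwo h₂ h₁ Y' (φ ≫ v) := by
  simp [toExtTwo_apply]

end Abelian

/-! ### The complex as short exact sequences of modules over `Aᵉ`. -/

section Env

variable {A : Type u} [Ring A] [Algebra k A]

variable (k A) in
/-- The multiplication map as a morphism of left modules onto the diagonal bimodule. -/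
def mulDiag : Env k A →ₗ[Env k A] diagonalBimodule k A :=
  LinearMap.toSpanSingleton (Env k A) (diagonalBimodule k A) (1 : A)

lemma mulDiag_apply (w : Env k A) : mulDiag k A w = (mulMap w : A) := by
  induction w using TensorProduct.induction_on with
  | zero => simp; rfl
  | add x y hx hy => rw [map_add, map_add, hx, hy]; rfl
  | tmul a b =>
    change (TensorProduct.Algebra.module.toSMul.smul (a ⊗ₜ[k] b) (1 : A) : A) = a * b.unop
    exact (TensorProduct.Algebra.smul_def a b (1 : A)).trans (by simp)

lemma mulDiag_surjective : Function.Surjective (mulDiag k A) := fun a =>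
  ⟨(show A from a) ⊗ₜ 1, by rw [mulDiag_apply]; exact mul_one (show A from a)⟩

variable (k A) in
/-- The kernel of the multiplication map, the bimodule of noncommutative differentials. -/
abbrev kerMul : ModuleCat.{u} (Env k A) := ModuleCat.of (Env k A) (LinearMap.ker (mulDiag k A))

variable (k A) in
/-- The inclusion of the kernel of the multiplication map. -/
def kerIncl : kerMul k A ⟶ outerBimodule k A :=
  ModuleCat.ofHom (LinearMap.ker (mulDiag k A)).subtype

variable (k A) in
/-- The multiplication map as a morphism in the category of modules. -/
def mulHom : outerBimodule k A ⟶ diagonalBimodule k A :=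
  ModuleCat.ofHom (Y := diagonalBimodule k A) (mulDiag k A)

lemma kerIncl_comp : kerIncl k A ≫ mulHom k A = 0 := by
  ext x; exact x.2

lemma shortExact_mul : (ShortComplex.mk _ _ (kerIncl_comp (k := k) (A := A))).ShortExact where
  exact := (ShortComplex.moduleCat_exact_iff _).2 fun x hx => ⟨⟨x, hx⟩, rfl⟩
  mono_f := (ModuleCat.mono_iff_injective _).2 Subtype.val_injective
  epi_g := (ModuleCat.epi_iff_surjective _).2 mulDiag_surjective

lemma mem_ker_mulDiag {w : Env k A} : w ∈ LinearMap.ker (mulDiag k A) ↔ mulMap w = 0 := by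
  rw [LinearMap.mem_ker, mulDiag_apply]; rfl

variable (k A) in
/-- The free bimodule of rank `n`. -/
abbrev freeBimodule (n : ℕ) : ModuleCat.{u} (Env k A) := ModuleCat.of (Env k A) (Fin n → Env k A)

instance : Projective (outerBimodule k A) :=
  (IsProjective.iff_projective (Env k A)).1 inferInstance

instance : Projective (freeBimodule k A n) :=
  (IsProjective.iff_projective (Fin n → Env k A)).1 inferInstance

/-- The map from the free bimodule with `e_j ↦ x_j ⊗ 1 - 1 ⊗ x_j`. -/
def diffMap (x : Fin n → A) : freeBimodule k A n ⟶ kerMul k A :=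
  ModuleCat.ofHom (LinearMap.codRestrict _
    (Fintype.linearCombination (Env k A) fun j => (diff (x j) : Env k A)) (by
      intro z
      rw [mem_ker_mulDiag, Fintype.linearCombination_apply, map_sum]
      exact Finset.sum_eq_zero fun j _ => mulMap_mul_diff ..))

/-- Evaluation of a morphism to the outer bimodule, as an element of the enveloping algebra. -/
def eval {X : ModuleCat.{u} (Env k A)} (φ : X ⟶ outerBimodule k A) (x : X) : Env k A := φ x

lemma hom_ext_eval {X : ModuleCat.{u} (Env k A)} {φ ψ : X ⟶ outerBimodule k A}
    (h : ∀ x, eval φ x = eval ψ x) : φ = ψ :=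
  ModuleCat.hom_ext (LinearMap.ext h)

lemma eval_comp {X Y : ModuleCat.{u} (Env k A)} (φ : X ⟶ Y) (ψ : Y ⟶ outerBimodule k A) (x : X) :
    eval (φ ≫ ψ) x = eval ψ (φ x) := rfl

lemma eval_map_zero {X : ModuleCat.{u} (Env k A)} (φ : X ⟶ outerBimodule k A) :
    eval φ 0 = 0 := map_zero φ.hom

lemma eval_outer (φ : outerBimodule k A ⟶ outerBimodule k A) (w : Env k A) :
    eval φ w = w * eval φ (1 : Env k A) := by
  have h : eval φ (w * 1 : Env k A) = w * eval φ (1 : Env k A) := φ.hom.map_smul w (1 : Env k A)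
  rwa [mul_one] at h

lemma eval_free (φ : freeBimodule k A n ⟶ outerBimodule k A) (z : Fin n → Env k A) :
    eval φ z = ∑ j, z j * eval φ (Pi.single j 1 : Fin n → Env k A) := by
  have h := LinearMap.pi_apply_eq_sum_univ φ.hom z
  refine h.trans (Finset.sum_congr rfl fun j _ => ?_)
  have : (fun i => if j = i then (1 : Env k A) else 0) = Pi.single j 1 := by
    ext i; simp [Pi.single_apply, eq_comm]
  rw [this]; rfl

lemma eval_rightMul (w v : Env k A) : eval (rightMul k A w) v = v * w := rfl

lemma eq_rightMul (φ : outerBimodule k A ⟶ outerBimodule k A) :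
    φ = rightMul k A (eval φ (1 : Env k A)) :=
  hom_ext_eval fun w => eval_outer φ w

lemma rightMul_comp (w v : Env k A) : rightMul k A w ≫ rightMul k A v = rightMul k A (w * v) :=
  hom_ext_eval fun u => mul_assoc (show Env k A from u) w v

end Env

variable (M) in
/-- The map from the bimodule of relations to the free bimodule on the generators. -/
def relMap : outerBimodule k (QuadraticAlg M) ⟶ freeBimodule k (QuadraticAlg M) n :=
  ModuleCat.ofHom (LinearMap.toSpanSingleton _ _ (diffCol M))

lemma relMap_apply (w : Env k (QuadraticAlg M)) :
    relMap M w = fun j => w * diffCol M j := rfl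

lemma relMap_comp (hanti : M.transpose = -M) : relMap M ≫ diffMap (gen M) = 0 := by
  refine ModuleCat.hom_ext (LinearMap.ext fun (w : Env k (QuadraticAlg M)) => Subtype.ext ?_)
  change ∑ j, (w * diffCol M j) * diff (gen M j) = 0
  simp only [mul_assoc, ← Finset.mul_sum, sum_diffCol_mul_diff hanti, mul_zero]

lemma shortExact_rel (hM0 : M ≠ 0) (hgd : globalDimension (QuadraticAlg M) ≤ 2)
    (hanti : M.transpose = -M) : (ShortComplex.mk _ _ (relMap_comp hanti)).ShortExact where
  exact := (ShortComplex.moduleCat_exact_iff _).2 fun z hz => by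
    obtain ⟨w, hw⟩ := exists_eq_mul_diffCol hanti (congrArg Subtype.val hz)
    exact ⟨w, funext fun j => (hw j).symm⟩
  mono_f := (ModuleCat.mono_iff_injective _).2 <|
    (injective_iff_map_eq_zero (relMap M).hom).2 fun w hw =>
      eq_zero_of_mul_diffCol hM0 hgd fun j => congrFun hw j
  epi_g := (ModuleCat.epi_iff_surjective _).2 fun ⟨w, hw⟩ => by
    obtain ⟨z, rfl⟩ := exists_eq_sum_mul_diff (mem_ker_mulDiag.1 hw)
    exact ⟨z, rfl⟩

/-! ### The finite resolution, vanishing of `HH⁰`, and duality. -/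

lemma hasFiniteProjectiveBimoduleResolution (hM0 : M ≠ 0)
    (hgd : globalDimension (QuadraticAlg M) ≤ 2) (hanti : M.transpose = -M) :
    HasFiniteProjectiveBimoduleResolution k (QuadraticAlg M) := by
  obtain ⟨P, h0, h1, h2, h3⟩ := exists_projectiveResolution_of_shortExact
    (shortExact_rel hM0 hgd hanti) shortExact_mul
  have hP (i : ℕ) (hi : 2 < i) : Limits.IsZero (P.complex.X i) := by
    obtain ⟨m, rfl⟩ := Nat.exists_eq_add_of_le' hi
    exact h3 m
  refine ⟨P, fun i => ?_, 2, hP⟩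
  match i with
  | 0 => rw [h0]; exact inferInstanceAs (Module.Finite (Env k _) (Env k _))
  | 1 => rw [h1]; exact inferInstanceAs (Module.Finite (Env k _) (Fin n → Env k _))
  | 2 => rw [h2]; exact inferInstanceAs (Module.Finite (Env k _) (Env k _))
  | m + 3 =>
    have := ModuleCat.subsingleton_of_isZero (h3 m)
    infer_instance

lemma eq_zero_of_diff_mul (hM0 : M ≠ 0) (hgd : globalDimension (QuadraticAlg M) ≤ 2)
    {w : Env k (QuadraticAlg M)} (hw : ∀ j, diff (gen M j) * w = 0) : w = 0 := by
  have h (j) : swap w * diff (gen M j) = 0 := by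
    have := congrArg swap (hw j)
    rw [swap_mul, swap_diff, env_mul_neg, map_zero, neg_eq_zero] at this
    exact this
  have h' : swap w = 0 := eq_zero_of_mul_diffCol hM0 hgd fun j => by
    simp only [diffCol, Finset.mul_sum, mul_smul_comm, h, smul_zero, Finset.sum_const_zero]
  rw [← swap_swap w, h', map_zero]

/-- A map `A → Aᵉ` is determined by the image `w` of `1`, and `diff x_j * w = 0` because
multiplication kills `diff x_j`. -/
lemma hh_zero_eq_zero (hM0 : M ≠ 0) (hgd : globalDimension (QuadraticAlg M) ≤ 2)
    (ξ : HH k (QuadraticAlg M) 0 (outerBimodule k (QuadraticAlg M))) : ξ = 0 := by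
  obtain ⟨φ, rfl⟩ := Abelian.Ext.homEquiv₀.symm.surjective ξ
  have hφ : φ = 0 := by
    have hepi : Epi (mulHom k (QuadraticAlg M)) := shortExact_mul.epi_g
    rw [← cancel_epi (mulHom k (QuadraticAlg M)), Limits.comp_zero]
    have h1 : eval (mulHom k (QuadraticAlg M) ≫ φ) (1 : Env k (QuadraticAlg M)) = 0 := by
      refine eq_zero_of_diff_mul hM0 hgd fun j => ?_
      have h2 : mulDiag k (QuadraticAlg M) (diff (gen M j)) = 0 :=
        mem_ker_mulDiag.2 (by simpa using mulMap_mul_diff (k := k) 1 (gen M j))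
      rw [← eval_outer]
      change eval φ (mulDiag k (QuadraticAlg M) (diff (gen M j))) = 0
      rw [h2, eval_map_zero]
    refine hom_ext_eval fun (w : Env k (QuadraticAlg M)) => (eval_outer _ w).trans ?_
    rw [h1, mul_zero]
    rfl
  rw [hφ, Abelian.Ext.homEquiv₀_symm_apply, Abelian.Ext.mk₀_zero]

/-- Duality: for an invertible matrix the dual of the bimodule resolution is exact in the middle. -/
lemma exists_eq_diff_mul (hanti : M.transpose = -M) (hM : IsUnit M)
    {w : Fin n → Env k (QuadraticAlg M)} (hw : ∑ j, diffCol M j * w j = 0) :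
    ∃ v, ∀ j, w j = diff (gen M j) * v := by
  have h := congrArg swap hw
  simp only [map_sum, swap_mul, swap_diffCol, env_mul_neg, Finset.sum_neg_distrib, map_zero,
    neg_eq_zero] at h
  have h1 : ∑ i, (∑ j, M i j • swap (w j)) * diff (gen M i) = 0 := by
    rw [← h]
    simp only [diffCol, Finset.mul_sum, Finset.sum_mul, mul_smul_comm, smul_mul_assoc]
    exact Finset.sum_comm
  obtain ⟨u, hu⟩ := exists_eq_mul_diffCol hanti h1
  have hanti' (i j : Fin n) : M j i = - M i j := congrFun (congrFun hanti i) j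
  -- Antisymmetry rewrites `u * diffCol M i` as `-∑ j, M i j • (u * diff x_j)`; `M` can then be
  -- cancelled.
  have h2 (i : Fin n) : ∑ j, M i j • (swap (w j) + u * diff (gen M j)) = 0 := by
    simp only [smul_add, Finset.sum_add_distrib, hu, diffCol, Finset.mul_sum]
    rw [← Finset.sum_add_distrib]
    refine Finset.sum_eq_zero fun j _ => ?_
    rw [mul_smul_comm, ← add_smul, hanti' i j, neg_add_cancel]
    exact zero_smul k (u * diff (gen M j))
  obtain ⟨N, hN⟩ := hM.exists_left_inv
  have h3 (l : Fin n) : swap (w l) + u * diff (gen M l) = 0 := by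
    have h4 : ∑ i, N l i • ∑ j, M i j • (swap (w j) + u * diff (gen M j)) =
        swap (w l) + u * diff (gen M l) := by
      simp only [Finset.smul_sum, smul_smul]
      rw [Finset.sum_comm]
      simp only [← Finset.sum_smul]
      have (j : Fin n) : ∑ i, N l i * M i j = (1 : Matrix (Fin n) (Fin n) k) l j := by
        rw [← hN]; rfl
      simp only [this, Matrix.one_apply, ite_smul, one_smul]
      rw [Finset.sum_eq_single l]
      · simp
      · intro j _ hj
        rw [if_neg (Ne.symm hj)]
        exact zero_smul k (swap (w j) + u * diff (gen M j))
      · simp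
    rw [← h4]
    exact Finset.sum_eq_zero fun i _ => by rw [h2, smul_zero]
  refine ⟨swap u, fun j => ?_⟩
  rw [← swap_swap (w j), eq_neg_of_add_eq_zero_left (h3 j), map_neg, swap_mul, swap_diff,
    env_neg_mul, neg_neg]

/-! ### `HH²` as a quotient of `Aᵉ`, and the Calabi–Yau criterion. -/

variable (hM0 : M ≠ 0) (hgd : globalDimension (QuadraticAlg M) ≤ 2) (hanti : M.transpose = -M)

/-- The class in `HH²(A, A ⊗ A)` of an element of the enveloping algebra. -/
def hhTwo : Env k (QuadraticAlg M) →+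
    HH k (QuadraticAlg M) 2 (outerBimodule k (QuadraticAlg M)) :=
  (toExtTwo (shortExact_rel hM0 hgd hanti) shortExact_mul
    (outerBimodule k (QuadraticAlg M))).comp
    { toFun := rightMul k (QuadraticAlg M)
      map_zero' := hom_ext_eval fun w => mul_zero (show Env k (QuadraticAlg M) from w)
      map_add' := fun a b =>
        hom_ext_eval fun w => mul_add (show Env k (QuadraticAlg M) from w) a b }

lemma hhTwo_apply (w : Env k (QuadraticAlg M)) : hhTwo hM0 hgd hanti w =
    toExtTwo (shortExact_rel hM0 hgd hanti) shortExact_mul _ (rightMul k (QuadraticAlg M) w) := rfl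

lemma hhTwo_surjective : Function.Surjective (hhTwo hM0 hgd hanti) := by
  intro ξ
  obtain ⟨φ, rfl⟩ := toExtTwo_surjective (shortExact_rel hM0 hgd hanti) shortExact_mul ξ
  exact ⟨eval φ (1 : Env k (QuadraticAlg M)), by rw [hhTwo_apply, ← eq_rightMul]⟩

lemma hhTwo_eq_zero_iff (w : Env k (QuadraticAlg M)) : hhTwo hM0 hgd hanti w = 0 ↔
    ∃ v : Fin n → Env k (QuadraticAlg M), w = ∑ j, diffCol M j * v j := by
  rw [hhTwo_apply, toExtTwo_eq_zero_iff]
  constructor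
  · rintro ⟨ψ, hψ⟩
    refine ⟨fun j => eval ψ (Pi.single j 1 : Fin n → Env k (QuadraticAlg M)), ?_⟩
    have h : eval (rightMul k (QuadraticAlg M) w) (1 : Env k (QuadraticAlg M)) =
      eval ψ (relMap M (1 : Env k (QuadraticAlg M))) := by rw [hψ]; rfl
    rw [eval_rightMul, one_mul, relMap_apply] at h
    simp only [one_mul] at h
    rw [h]
    exact eval_free ψ (diffCol M)
  · rintro ⟨v, rfl⟩
    refine ⟨ModuleCat.ofHom (Y := outerBimodule k (QuadraticAlg M))
      (Fintype.linearCombination _ v), hom_ext_eval fun (w : Env k (QuadraticAlg M)) => ?_⟩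
    change w * ∑ j, diffCol M j * v j = ∑ j, (w * diffCol M j) * v j
    simp only [Finset.mul_sum, mul_assoc]

lemma extRightAct_hhTwo (w v : Env k (QuadraticAlg M)) :
    extRightAct (hhTwo hM0 hgd hanti w) v = hhTwo hM0 hgd hanti (w * v) := by
  rw [extRightAct, hhTwo_apply, toExtTwo_comp, rightMul_comp]
  rfl

/-- For invertible `M` the right ideal of the `diffCol M j` is that of the `diff x_j`, which `swap`
exchanges with the kernel of multiplication. -/
lemma exists_sum_diffCol_mul_iff (hM : IsUnit M) (w : Env k (QuadraticAlg M)) :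
    (∃ v : Fin n → Env k (QuadraticAlg M), w = ∑ j, diffCol M j * v j) ↔
      mulMap (swap w) = 0 := by
  constructor
  · rintro ⟨v, rfl⟩
    rw [map_sum, map_sum]
    refine Finset.sum_eq_zero fun j _ => ?_
    rw [swap_mul, swap_diffCol, diffCol_eq, env_mul_neg, map_neg, mulMap_mul_diff, neg_zero]
  · intro h
    obtain ⟨z, hz⟩ := exists_eq_sum_mul_diff h
    obtain ⟨N, hN⟩ := hM.exists_right_inv
    have hgen (j : Fin n) : diff (gen M j) = ∑ l, N l j • diffCol M l := by
      simp only [diffCol, Finset.smul_sum, smul_smul]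
      rw [Finset.sum_comm]
      simp only [← Finset.sum_smul]
      have (i : Fin n) : ∑ l, N l j * M i l = (1 : Matrix (Fin n) (Fin n) k) i j := by
        rw [← hN]; simp only [Matrix.mul_apply, mul_comm]
      simp only [this, Matrix.one_apply, ite_smul, one_smul]
      rw [Finset.sum_eq_single j]
      · simp
      · intro i _ hi
        rw [if_neg hi]
        exact zero_smul k (diff (gen M i) : Env k (QuadraticAlg M))
      · simp
    refine ⟨fun l => -∑ j, N l j • swap (z j), ?_⟩
    rw [← swap_swap w, hz, map_sum]
    simp only [swap_mul, swap_diff, env_neg_mul, env_mul_neg, Finset.sum_neg_distrib,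
      Finset.mul_sum, mul_smul_comm]
    rw [Finset.sum_comm]
    congr 1
    refine Finset.sum_congr rfl fun j _ => ?_
    rw [hgen, Finset.sum_mul]
    simp only [smul_mul_assoc]

include hM0 hgd hanti in
lemma isCalabiYau_of_isUnit (hM : IsUnit M) : IsCalabiYau k (QuadraticAlg M) 2 where
  one_le := by norm_num
  finite_resolution := hasFiniteProjectiveBimoduleResolution hM0 hgd hanti
  ext_eq_zero := by
    intro i hi ξ
    match i, hi with
    | 0, _ => exact hh_zero_eq_zero hM0 hgd ξ
    | 1, _ =>
      refine ext_one_eq_zero shortExact_mul (fun φ => ?_) ξ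
      have hepi : Epi (diffMap (k := k) (gen M)) := (shortExact_rel hM0 hgd hanti).epi_g
      obtain ⟨v, hv⟩ := exists_eq_diff_mul (M := M) hanti hM
        (w := fun j => eval (diffMap (k := k) (gen M) ≫ φ)
          (Pi.single j 1 : Fin n → Env k (QuadraticAlg M))) (by
          have h0 : diffMap (k := k) (gen M) (diffCol M) = 0 :=
            Subtype.ext (sum_diffCol_mul_diff hanti)
          rw [← eval_free (diffMap (k := k) (gen M) ≫ φ) (diffCol M), eval_comp, h0,
            eval_map_zero])
      refine ⟨rightMul k _ v, ?_⟩
      rw [← cancel_epi (diffMap (k := k) (gen M))]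
      refine hom_ext_eval fun (z : Fin n → Env k (QuadraticAlg M)) => ?_
      rw [eval_free]
      simp only [hv]
      change _ = (∑ j, z j * diff (gen M j)) * v
      simp only [Finset.sum_mul, mul_assoc]
    | m + 3, _ =>
      have := hasProjectiveDimensionLT_three (shortExact_rel hM0 hgd hanti) shortExact_mul
      exact Abelian.Ext.eq_zero_of_hasProjectiveDimensionLT ξ 3 (by omega)
  ext_equiv := by
    let p : Env k (QuadraticAlg M) →+ QuadraticAlg M := (mulMap ∘ₗ swap).toAddMonoidHom
    have hp_apply (w) : p w = mulMap (swap w) := rfl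
    have hp : Function.Surjective p := fun a => ⟨1 ⊗ₜ MulOpposite.op a, by simp [hp_apply]⟩
    -- `HH²` and `A` are quotients of `Aᵉ` by the same subgroup.
    have hker : (hhTwo hM0 hgd hanti).ker = p.ker := by
      ext w
      rw [AddMonoidHom.mem_ker, AddMonoidHom.mem_ker, hhTwo_eq_zero_iff,
        exists_sum_diffCol_mul_iff hM]
      rfl
    let e := ((QuotientAddGroup.quotientKerEquivOfSurjective _
      (hhTwo_surjective hM0 hgd hanti)).symm.trans
      (QuotientAddGroup.quotientAddEquivOfEq hker)).trans
      (QuotientAddGroup.quotientKerEquivOfSurjective p hp)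
    have he (w) : e (hhTwo hM0 hgd hanti w) = p w := by
      have h : (QuotientAddGroup.quotientKerEquivOfSurjective _
          (hhTwo_surjective hM0 hgd hanti)).symm (hhTwo hM0 hgd hanti w) = (w : _ ⧸ _) := by
        rw [AddEquiv.symm_apply_eq]; rfl
      simp only [e, AddEquiv.trans_apply, h]
      rfl
    refine ⟨e, fun ξ b c => ?_⟩
    obtain ⟨w, rfl⟩ := hhTwo_surjective hM0 hgd hanti ξ
    rw [extRightAct_hhTwo, he, he, hp_apply, hp_apply, swap_mul, swap_tmul, mulMap_tmul_mul,
      MulOpposite.unop_op]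

/-- The morphism to the dual numbers which is the augmentation on the left factor and
`x_i ↦ v i • ε` on the right factor. -/
def envToDual (M : Matrix (Fin n) (Fin n) k) (v : Fin n → k) :
    Env k (QuadraticAlg M) →ₐ[k] DualNumber k :=
  Algebra.TensorProduct.lift ((Algebra.ofId k (DualNumber k)).comp (aug M))
    ((toDual M v).fromOpposite fun _ _ => Commute.all _ _) fun _ _ => Commute.all _ _

lemma envToDual_tmul (v : Fin n → k) (a b : QuadraticAlg M) :
    envToDual M v (a ⊗ₜ MulOpposite.op b) =
      algebraMap k (DualNumber k) (aug M a) * toDual M v b := by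
  simp [envToDual, Algebra.ofId_apply]

include hM0 hgd hanti in
lemma isUnit_of_isCalabiYau (h : IsCalabiYau k (QuadraticAlg M) 2) : IsUnit M := by
  rw [Matrix.isUnit_iff_isUnit_det, isUnit_iff_ne_zero]
  intro hdet
  obtain ⟨v, hv0, hv⟩ := Matrix.exists_vecMul_eq_zero_iff.2 hdet
  obtain ⟨e, he⟩ := h.ext_equiv
  refine hv0 (funext fun l => ?_)
  let Θ := hhTwo hM0 hgd hanti
  have h1 : aug M (gen M l * e (Θ 1)) = 0 := by simp
  -- Left multiplication by `x_l` on `A` is the action of `1 ⊗ x_l`, right multiplication by `x_j`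
  -- that of `x_j ⊗ 1`. Lifting `x_l * e (Θ 1) = ∑ j, a j * x_j` to `Aᵉ` gives an identity modulo
  -- the right ideal of the `diffCol M j`.
  obtain ⟨a, ha⟩ := exists_sum_mul_gen h1
  choose w hw using fun j => hhTwo_surjective hM0 hgd hanti (e.symm (a j))
  have h2 : Θ (1 ⊗ₜ MulOpposite.op (gen M l) - ∑ j, w j * (gen M j ⊗ₜ 1)) = 0 := by
    rw [map_sub, map_sum, sub_eq_zero]
    apply e.injective
    have hl := he (Θ 1) 1 (gen M l)
    rw [extRightAct_hhTwo, one_mul, mul_one, ha] at hl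
    rw [hl, map_sum]
    refine Finset.sum_congr rfl fun j _ => ?_
    have hj := he (Θ (w j)) (gen M j) 1
    rw [extRightAct_hhTwo, one_mul, MulOpposite.op_one] at hj
    rw [hj, hw, AddEquiv.apply_symm_apply]
  obtain ⟨z, hz⟩ := (hhTwo_eq_zero_iff ..).1 h2
  -- Since `v M = 0`, only `1 ⊗ x_l` survives, with value `v l • ε`.
  have h3 := congrArg (envToDual M v) hz
  have h4 (j : Fin n) : envToDual M v (diffCol M j) = 0 := by
    rw [diffCol_eq, diff, ← MulOpposite.op_one, map_sub, envToDual_tmul, envToDual_tmul,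
      toDual_col, hv]
    simp [col]
  have h5 (j : Fin n) : envToDual M v (gen M j ⊗ₜ 1) = 0 := by
    rw [← MulOpposite.op_one, envToDual_tmul]
    simp
  rw [map_sub, map_sum, map_sum, envToDual_tmul] at h3
  simp only [map_mul, h4, h5, mul_zero, zero_mul, Finset.sum_const_zero, sub_zero, map_one, one_mul,
    toDual_gen] at h3
  exact TrivSqZeroExt.inr_injective h3

end QuadraticCY

end

theorem mainTheorem12 {k : Type u} [Field k] {n : ℕ} (M : Matrix (Fin n) (Fin n) k)
    (hM0 : M ≠ 0) (hgd : QuadraticCY.globalDimension (QuadraticCY.QuadraticAlg M) = 2)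
    (hanti : M.transpose = -M) :
    (∀ ξ : QuadraticCY.HH k (QuadraticCY.QuadraticAlg M) 0
        (QuadraticCY.outerBimodule k (QuadraticCY.QuadraticAlg M)), ξ = 0) ∧
      (QuadraticCY.IsCalabiYau k (QuadraticCY.QuadraticAlg M) 2 ↔ IsUnit M) :=
  ⟨QuadraticCY.hh_zero_eq_zero hM0 hgd.le,
    QuadraticCY.isUnit_of_isCalabiYau hM0 hgd.le hanti,
    QuadraticCY.isCalabiYau_of_isUnit hM0 hgd.le hanti⟩
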